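/- Let $W=\{0,1,2,3,4,5\}$, let $W_*=\bigcup_{n\ge 0}W^n$ be the set of finite words over $W$ (with $|w|=n$ for $w\in W^n$), and let $W_\infty=W^{\mathbb N}$ be the set of infinite words. Let $\sim$ be the equivalence relation on $W_\infty$ generated by the following identifications: for all $w\in W_*$, $i\in W$ and $v\in\{0,5\}^{\mathbb N}$, with $j\in W$, $j\equiv i+1 \pmod 6$, $$wi1v\sim wj1v,\quad wi2v\sim wj2v\quad\text{if } i \text{ is even},\qquad wi3v\sim wj3v,\quad wi4v\sim wj4v\quad\text{if } i\text{ is odd}.$$ Let $K=W_\infty/{\sim}$ be the Strichartz hexacarpet and $\pi:W_\infty\to K$ the quotient map. For $i\in W$ let $f_i:K\to K$ be the map induced by $v\mapsto iv$ on $W_\infty$, and for $w=w_1\cdots w_n\in W_*$ let $K_w=f_{w_1}\circ\cdots\circ f_{w_n}(K)$ (so $K_\emptyset=K$). For $x,y\in K$, a chain connecting $x$ and $y$ is a finite sequence $w^{(1)},\dots,w^{(m)}\in W_*$, $m\ge1$, with $x\in K_{w^{(1)}}$, $y\in K_{w^{(m)}}$ and $K_{w^{(i)}}\cap K_{w^{(i+1)}}\neq\emptyset$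 for $1\le i\le m-1$. For $\mu\in(0,1)$ let $$d_\mu(x,y)=\inf\Big\{\sum_{i=1}^m\mu^{|w^{(i)}|}: w^{(1)},\dots,w^{(m)}\text{ is a chain connecting }x\text{ and }y\Big\}.$$ A distance function $d$ on a set $X$ satisfies the $\theta$-chain condition if there is a constant $C>0$ such that for all $x,y\in X$ and all integers $n\ge1$ there are $x_0,\dots,x_n\in X$ with $x_0=x$, $x_n=y$ and $$d(x_i,x_{i+1})\le C\,\frac{d(x,y)}{n^\theta}\quad\text{for all } i=0,\dots,n-1;$$ it satisfies the chain condition if this holds with $\theta=1$. **Proposition.** For every $\mu\in[1/2,1)$, the metric $d_\mu$ does not satisfy the chain condition, and it satisfies the $\theta$-chain condition for every $\theta\in(0,-\log\mu/\log2)$. -/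

import Mathlib

namespace Hexacarpet

/-- Finite words over the alphabet `W = {0,1,2,3,4,5}`. -/
abbrev Word : Type := List (Fin 6)

/-- Infinite words over the alphabet `W = {0,1,2,3,4,5}`, with the product topology. -/
abbrev InfWord : Type := ℕ → Fin 6

/-- The shift `σ_i : w₁w₂… ↦ i w₁w₂…`. -/
def shift (i : Fin 6) (v : InfWord) : InfWord
  | 0 => i
  | n + 1 => v n

/-- Concatenation `wv` of a finite word `w` and an infinite word `v`. -/
def prepend : Word → InfWord → InfWord
  | [], v => v
  | i :: w, v => shift i (prepend w v)

/-- The elementary identifications. With `j = i + 1 (mod 6)` (addition in `Fin 6` is modulo 6) and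
`v` an infinite word in the letters `0, 5`: if `i` is even, `wi1v ∼ wj1v` and `wi2v ∼ wj2v`;
if `i` is odd, `wi3v ∼ wj3v` and `wi4v ∼ wj4v`. -/
inductive Glue : InfWord → InfWord → Prop
  | even (w : Word) (i a : Fin 6) (v : InfWord) (hi : Even i.val) (ha : a = 1 ∨ a = 2)
      (hv : ∀ n, v n = 0 ∨ v n = 5) :
      Glue (prepend w (shift i (shift a v))) (prepend w (shift (i + 1) (shift a v)))
  | odd (w : Word) (i a : Fin 6) (v : InfWord) (hi : Odd i.val) (ha : a = 3 ∨ a = 4)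
      (hv : ∀ n, v n = 0 ∨ v n = 5) :
      Glue (prepend w (shift i (shift a v))) (prepend w (shift (i + 1) (shift a v)))

theorem Glue.shift {x y : InfWord} (h : Glue x y) (k : Fin 6) :
    Glue (shift k x) (shift k y) := by
  cases h with
  | even w i a v hi ha hv => exact Glue.even (k :: w) i a v hi ha hv
  | odd w i a v hi ha hv => exact Glue.odd (k :: w) i a v hi ha hv

/-- The equivalence relation on infinite words generated by the elementary identifications. -/
abbrev glueSetoid : Setoid InfWord := Relation.EqvGen.setoid Glue

/-- The Strichartz hexacarpet (with the quotient topology). -/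
abbrev Carpet : Type := Quotient glueSetoid

theorem glueSetoid_shift (k : Fin 6) {x y : InfWord} (h : glueSetoid x y) :
    glueSetoid (shift k x) (shift k y) := by
  induction h with
  | rel x y h => exact .rel _ _ (h.shift k)
  | refl x => exact .refl _
  | symm x y _ ih => exact .symm _ _ ih
  | trans x y z _ _ ih₁ ih₂ => exact .trans _ _ _ ih₁ ih₂

/-- The map `f_i : K → K` with `π ∘ σ_i = f_i ∘ π`. -/
def letterMap (i : Fin 6) : Carpet → Carpet :=
  Quotient.map (shift i) fun _ _ h => glueSetoid_shift i h

/-- The map `f_w = f_{w₁} ∘ ⋯ ∘ f_{wₙ}`, with `f_∅ = id`. -/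
def wordMap : Word → Carpet → Carpet
  | [] => id
  | i :: w => letterMap i ∘ wordMap w

/-- The cell `K_w = f_w(K)`. -/
def cell (w : Word) : Set Carpet := wordMap w '' Set.univ

/-- The finite sequence of words `c = {w⁽¹⁾, …, w⁽ᵐ⁾}` is a chain connecting `x` and `y`: consecutive
cells meet, `x` lies in the first cell and `y` in the last one. In particular, `m ≥ 1`. -/
def IsChainConnecting (c : List Word) (x y : Carpet) : Prop :=
  c.IsChain (fun u v => (cell u ∩ cell v).Nonempty) ∧
    ∃ hc : c ≠ [], x ∈ cell (c.head hc) ∧ y ∈ cell (c.getLast hc)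

/-- The weight `∑ᵢ g_μ(w⁽ⁱ⁾)` of a chain, where `g_μ(w) = μ^|w|`. -/
noncomputable def chainWeight (μ : ℝ) (c : List Word) : ℝ :=
  (c.map fun w => μ ^ w.length).sum

/-- The intrinsic metric `d_μ(x, y)`: the infimum of the weights of the chains connecting
`x` and `y`. -/
noncomputable def intrinsicDist (μ : ℝ) (x y : Carpet) : ℝ :=
  sInf {s | ∃ c : List Word, IsChainConnecting c x y ∧ s = chainWeight μ c}

/-- The chain condition for a distance function `d` on `X`. -/
def ChainCondition {X : Type*} (d : X → X → ℝ) : Prop :=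
  ∃ C : ℝ, 0 < C ∧ ∀ x y : X, ∀ n : ℕ, 1 ≤ n → ∃ z : Fin (n + 1) → X,
    z 0 = x ∧ z (Fin.last n) = y ∧
      ∀ i : Fin n, d (z i.castSucc) (z i.succ) ≤ C * (d x y / n)

/-- The `θ`-chain condition for a distance function `d` on `X`. -/
def ThetaChainCondition {X : Type*} (θ : ℝ) (d : X → X → ℝ) : Prop :=
  ∃ C : ℝ, 0 < C ∧ ∀ x y : X, ∀ n : ℕ, 1 ≤ n → ∃ z : Fin (n + 1) → X,
    z 0 = x ∧ z (Fin.last n) = y ∧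
      ∀ i : Fin n, d (z i.castSucc) (z i.succ) ≤ C * (d x y / (n : ℝ) ^ θ)

end Hexacarpet

namespace Hexacarpet

/-! Cells of level m correspond to the triangles of the m-fold barycentric subdivision, meeting
across sides. Everything depends on how many of them separate two points: at most order m·2^m,
attained by the two ends of a side. The factor m explains both claims.

Upper bound: turning round a corner takes 2^m cells, and following a side b_m cells with b_{m+1} =
2(b_m + 2^m); hence `joined`. Since θ < -log μ / log 2 means 2 < μ^(-1/θ), the factor m is absorbed.
So an almost optimal path of weight at most s refines to cells of weight at most s/n^θ and total
weight O(n·s/n^θ) (`exists_refinement`), and is cut into n pieces (`Path.exists_subdivision`).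

Lower bound: for each M there is a function on the carpet that varies by at most 4·2^(-k) on a cell
of level k ≥ M (`dist_carpetPotential_le`) but by M/2 between the ends of side C. It is a limit of
values on sides of triangles; each of the first M subdivisions shifts these by half a corner value.
Under the chain condition with constant C and n large, all steps use cells of level at least M, and
as μ ≥ 1/2 the total variation is at most 8C, whatever M is. -/

/-! ### Cells and paths of cells -/

theorem wordMap_append (u w : Word) (x : Carpet) :
    wordMap (u ++ w) x = wordMap u (wordMap w x) := by
  induction u with
  | nil => rfl
  | cons i u ih => simp [wordMap, ih]

theorem wordMap_mem_cell (u : Word) {w : Word} {x : Carpet} (hx : x ∈ cell w) :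
    wordMap u x ∈ cell (u ++ w) := by
  obtain ⟨y, -, rfl⟩ := hx
  exact ⟨y, trivial, wordMap_append u w y⟩

theorem mem_cell_nil (x : Carpet) : x ∈ cell [] := ⟨x, trivial, rfl⟩

theorem wordMap_mk (w : Word) (v : InfWord) :
    wordMap w (Quotient.mk _ v) = Quotient.mk _ (prepend w v) := by
  induction w with
  | nil => rfl
  | cons i w ih => simp only [wordMap, Function.comp_apply, ih]; rfl

theorem shift_head_tail (v : InfWord) : shift (v 0) (fun n => v (n + 1)) = v := by
  funext n
  cases n <;> rfl

theorem exists_letterMap_eq (x : Carpet) : ∃ i y, letterMap i y = x := by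
  induction x using Quotient.inductionOn with
  | h v =>
    refine ⟨v 0, Quotient.mk _ fun n => v (n + 1), ?_⟩
    change Quotient.mk _ (shift (v 0) fun n => v (n + 1)) = _
    rw [shift_head_tail]

theorem exists_mem_cell_of_length (n : ℕ) (x : Carpet) : ∃ w : Word, w.length = n ∧ x ∈ cell w := by
  induction n generalizing x with
  | zero => exact ⟨[], rfl, mem_cell_nil x⟩
  | succ n ih =>
    obtain ⟨i, y, rfl⟩ := exists_letterMap_eq x
    obtain ⟨w, hw, hy⟩ := ih y
    exact ⟨i :: w, by simp [hw], wordMap_mem_cell [i] hy⟩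

/-- There are points leading from `x` to `y` whose consecutive pairs lie in the cells of `c`. -/
def Path : Carpet → List Word → Carpet → Prop
  | x, [], y => x = y
  | x, w :: c, y => ∃ z, x ∈ cell w ∧ z ∈ cell w ∧ Path z c y

theorem Path.append {x y z : Carpet} {c c' : List Word} (h : Path x c y) (h' : Path y c' z) :
    Path x (c ++ c') z := by
  induction c generalizing x with
  | nil => obtain rfl : x = y := h; exact h'
  | cons w c ih =>
    obtain ⟨p, hx, hp, h⟩ := h
    exact ⟨p, hx, hp, ih h⟩

theorem Path.exists_of_append {x z : Carpet} {c c' : List Word} (h : Path x (c ++ c') z) :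
    ∃ y, Path x c y ∧ Path y c' z := by
  induction c generalizing x with
  | nil => exact ⟨x, rfl, h⟩
  | cons w c ih =>
    obtain ⟨p, hx, hp, h⟩ := h
    obtain ⟨y, h₁, h₂⟩ := ih h
    exact ⟨y, ⟨p, hx, hp, h₁⟩, h₂⟩

theorem Path.single {x y : Carpet} {w : Word} (hx : x ∈ cell w) (hy : y ∈ cell w) :
    Path x [w] y := ⟨y, hx, hy, rfl⟩

theorem Path.reverse {x y : Carpet} {c : List Word} (h : Path x c y) : Path y c.reverse x := by
  induction c generalizing x with
  | nil => exact Eq.symm h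
  | cons w c ih =>
    obtain ⟨p, hx, hp, h⟩ := h
    rw [List.reverse_cons]
    exact (ih h).append (Path.single hp hx)

theorem Path.map (u : Word) {x y : Carpet} {c : List Word} (h : Path x c y) :
    Path (wordMap u x) (c.map (u ++ ·)) (wordMap u y) := by
  induction c generalizing x with
  | nil => exact congrArg _ h
  | cons w c ih =>
    obtain ⟨p, hx, hp, h⟩ := h
    exact ⟨_, wordMap_mem_cell u hx, wordMap_mem_cell u hp, ih h⟩

theorem IsChainConnecting.path {c : List Word} {x y : Carpet} (h : IsChainConnecting c x y) :
    Path x c y := by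
  obtain ⟨hch, hne, hx, hy⟩ := h
  induction c generalizing x with
  | nil => exact absurd rfl hne
  | cons w c ih =>
    cases c with
    | nil => exact Path.single hx hy
    | cons w' c =>
      rw [List.isChain_cons_cons] at hch
      obtain ⟨⟨p, hp, hp'⟩, hch⟩ := hch
      exact ⟨p, hx, hp, ih hch (List.cons_ne_nil _ _) hp' (by simpa using hy)⟩

theorem Path.isChainConnecting {c : List Word} {x y : Carpet} (h : Path x c y) (hne : c ≠ []) :
    IsChainConnecting c x y := by
  induction c generalizing x with
  | nil => exact absurd rfl hne
  | cons w c ih =>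
    obtain ⟨p, hx, hp, h⟩ := h
    cases c with
    | nil =>
      obtain rfl : p = y := h
      exact ⟨List.isChain_singleton _, hne, hx, hp⟩
    | cons w' c =>
      obtain ⟨hch, hne', hp', hy⟩ := ih h (List.cons_ne_nil _ _)
      exact ⟨List.isChain_cons_cons.2 ⟨⟨p, hp, hp'⟩, hch⟩, hne, hx, by simpa using hy⟩

/-! ### Weights of paths and the intrinsic distance -/

section Weight

variable {μ : ℝ}

theorem chainWeight_nonneg (hμ : 0 ≤ μ) (c : List Word) : 0 ≤ chainWeight μ c :=
  List.sum_nonneg fun a ha => by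
    obtain ⟨w, -, rfl⟩ := List.mem_map.1 ha
    positivity

theorem chainWeight_cons (w : Word) (c : List Word) :
    chainWeight μ (w :: c) = μ ^ w.length + chainWeight μ c := by
  simp [chainWeight]

theorem chainWeight_append (c c' : List Word) :
    chainWeight μ (c ++ c') = chainWeight μ c + chainWeight μ c' := by
  simp [chainWeight]

theorem pow_length_le_chainWeight (hμ : 0 ≤ μ) {c : List Word} {w : Word} (hw : w ∈ c) :
    μ ^ w.length ≤ chainWeight μ c :=
  List.single_le_sum (fun a ha => by obtain ⟨w, -, rfl⟩ := List.mem_map.1 ha; positivity) _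
    (List.mem_map_of_mem hw)

theorem chainWeight_mono {ν : ℝ} (hμ : 0 ≤ μ) (h : μ ≤ ν) (c : List Word) :
    chainWeight μ c ≤ chainWeight ν c :=
  List.sum_le_sum fun _ _ => pow_le_pow_left₀ hμ h _

theorem chainWeight_eq_of_length {c : List Word} {m : ℕ} (h : ∀ w ∈ c, w.length = m) :
    chainWeight μ c = c.length * μ ^ m := by
  induction c with
  | nil => simp [chainWeight]
  | cons w c ih =>
    rw [chainWeight_cons, ih fun w hw => h w (List.mem_cons_of_mem _ hw), h w List.mem_cons_self]
    push_cast [List.length_cons]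
    ring

theorem intrinsicDist_nonneg (hμ : 0 ≤ μ) (x y : Carpet) : 0 ≤ intrinsicDist μ x y :=
  Real.sInf_nonneg fun _ ⟨c, _, hs⟩ => hs ▸ chainWeight_nonneg hμ c

theorem intrinsicDist_le_of_isChainConnecting (hμ : 0 ≤ μ) {c : List Word} {x y : Carpet}
    (h : IsChainConnecting c x y) : intrinsicDist μ x y ≤ chainWeight μ c :=
  csInf_le ⟨0, fun _ ⟨c, _, hs⟩ => hs ▸ chainWeight_nonneg hμ c⟩ ⟨c, h, rfl⟩

theorem intrinsicDist_self (hμ : 0 ≤ μ) (hμ' : μ < 1) (x : Carpet) : intrinsicDist μ x x = 0 := by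
  refine le_antisymm (ge_of_tendsto' (tendsto_pow_atTop_nhds_zero_of_lt_one hμ hμ') fun n => ?_)
    (intrinsicDist_nonneg hμ x x)
  obtain ⟨w, rfl, hx⟩ := exists_mem_cell_of_length n x
  refine (intrinsicDist_le_of_isChainConnecting hμ
    ((Path.single hx hx).isChainConnecting (List.cons_ne_nil _ _))).trans_eq ?_
  simp [chainWeight]

theorem Path.intrinsicDist_le (hμ : 0 ≤ μ) (hμ' : μ < 1) {c : List Word} {x y : Carpet}
    (h : Path x c y) : intrinsicDist μ x y ≤ chainWeight μ c := by
  cases c with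
  | nil =>
    obtain rfl : x = y := h
    exact (intrinsicDist_self hμ hμ' x).trans_le (chainWeight_nonneg hμ _)
  | cons w c =>
    exact intrinsicDist_le_of_isChainConnecting hμ (h.isChainConnecting (List.cons_ne_nil _ _))

theorem isChainConnecting_nil_word (x y : Carpet) : IsChainConnecting [[]] x y :=
  (Path.single (mem_cell_nil x) (mem_cell_nil y)).isChainConnecting (List.cons_ne_nil _ _)

theorem intrinsicDist_le_one (hμ : 0 ≤ μ) (x y : Carpet) : intrinsicDist μ x y ≤ 1 :=
  (intrinsicDist_le_of_isChainConnecting hμ (isChainConnecting_nil_word x y)).trans_eq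
    (by simp [chainWeight])

theorem exists_path_of_intrinsicDist_lt {x y : Carpet} {s : ℝ} (h : intrinsicDist μ x y < s) :
    ∃ c, Path x c y ∧ chainWeight μ c < s := by
  obtain ⟨_, ⟨c, hc, rfl⟩, hs⟩ := exists_lt_of_csInf_lt
    (s := {s | ∃ c : List Word, IsChainConnecting c x y ∧ s = chainWeight μ c})
    ⟨_, [[]], isChainConnecting_nil_word x y, rfl⟩ h
  exact ⟨c, hc.path, hs⟩

/-- A path of weight at most `n t` whose cells have weight at most `δ` can be cut into `n` pieces
of weight at most `t + δ`. -/
theorem Path.exists_subdivision (hμ : 0 ≤ μ) (hμ' : μ < 1) {t δ : ℝ} (ht : 0 ≤ t) (hδ : 0 ≤ δ)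
    (n : ℕ) {c : List Word} {x y : Carpet} (h : Path x c y) (hc : ∀ w ∈ c, μ ^ w.length ≤ δ)
    (hw : chainWeight μ c ≤ (n + 1 : ℕ) * t) :
    ∃ z : ℕ → Carpet, z 0 = x ∧ z (n + 1) = y ∧
      ∀ i < n + 1, intrinsicDist μ (z i) (z (i + 1)) ≤ t + δ := by
  -- Greedy cut: take cells until the weight reaches t; the last one overshoots by at most δ.
  have split : ∀ c : List Word, (∀ w ∈ c, μ ^ w.length ≤ δ) → ∀ t, 0 ≤ t → ∃ c₁ c₂, c = c₁ ++ c₂ ∧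
      chainWeight μ c₁ ≤ t + δ ∧ (c₂ = [] ∨ t ≤ chainWeight μ c₁) := by
    intro c
    induction c with
    | nil => exact fun _ t ht => ⟨[], [], rfl, by simp [chainWeight]; positivity, .inl rfl⟩
    | cons w c ih =>
      intro hc t ht
      have hwδ := hc w List.mem_cons_self
      by_cases htw : μ ^ w.length ≤ t
      · obtain ⟨c₁, c₂, rfl, h₁, h₂⟩ := ih (fun w hw => hc w (List.mem_cons_of_mem _ hw))
          (t - μ ^ w.length) (by linarith)
        refine ⟨w :: c₁, c₂, rfl, ?_, h₂.imp_right fun h₂ => ?_⟩ <;> rw [chainWeight_cons] <;>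
          linarith
      · refine ⟨[w], c, rfl, ?_, .inr ?_⟩ <;> simp [chainWeight] <;> linarith
  induction n generalizing c x with
  | zero =>
    refine ⟨fun i => if i = 0 then x else y, by simp, by simp, fun i hi => ?_⟩
    obtain rfl : i = 0 := by omega
    have := h.intrinsicDist_le hμ hμ'
    simp only [zero_add, Nat.cast_one, one_mul] at hw
    simpa using this.trans (hw.trans (by linarith))
  | succ n ih =>
    obtain ⟨c₁, c₂, rfl, h₁, h₂⟩ := split c hc t ht
    obtain ⟨p, hp₁, hp₂⟩ := h.exists_of_append
    have hw₂ : chainWeight μ c₂ ≤ (n + 1 : ℕ) * t := by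
      rcases h₂ with rfl | h₂
      · simp only [chainWeight, List.map_nil, List.sum_nil]; positivity
      · rw [chainWeight_append] at hw
        push_cast at hw ⊢
        linarith
    obtain ⟨z, hz₀, hz₁, hz⟩ := ih hp₂ (fun w hw => hc w (List.mem_append_right _ hw)) hw₂
    refine ⟨fun i => if i = 0 then x else z (i - 1), by simp, by simpa using hz₁, fun i hi => ?_⟩
    rcases i with _ | i
    · simpa [hz₀] using (hp₁.intrinsicDist_le hμ hμ').trans h₁
    · simpa using hz i (by omega)

end Weight

/-! ### Counting cells: any two points are joined by O(m·2^m) cells of level m -/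

/-- `x` and `y` can be joined by at most `N` cells of level `m`. -/
def Joined (m N : ℕ) (x y : Carpet) : Prop :=
  ∃ c, Path x c y ∧ (∀ w ∈ c, w.length = m) ∧ c.length ≤ N

theorem Joined.mono {m N N' : ℕ} {x y : Carpet} (h : Joined m N x y) (hN : N ≤ N') :
    Joined m N' x y := by
  obtain ⟨c, hc, hm, hl⟩ := h
  exact ⟨c, hc, hm, hl.trans hN⟩

theorem Joined.refl (m : ℕ) (x : Carpet) : Joined m 0 x x := ⟨[], rfl, by simp, by simp⟩

theorem Joined.symm {m N : ℕ} {x y : Carpet} (h : Joined m N x y) : Joined m N y x := by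
  obtain ⟨c, hc, hm, hl⟩ := h
  exact ⟨c.reverse, hc.reverse, by simpa using hm, by simpa using hl⟩

theorem Joined.trans {m N N' : ℕ} {x y z : Carpet} (h : Joined m N x y) (h' : Joined m N' y z) :
    Joined m (N + N') x z := by
  obtain ⟨c, hc, hm, hl⟩ := h
  obtain ⟨c', hc', hm', hl'⟩ := h'
  refine ⟨c ++ c', hc.append hc', fun w hw => ?_, by simp; omega⟩
  exact (List.mem_append.1 hw).elim (hm w) (hm' w)

theorem Joined.letterMap (i : Fin 6) {m N : ℕ} {x y : Carpet} (h : Joined m N x y) :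
    Joined (m + 1) N (letterMap i x) (letterMap i y) := by
  obtain ⟨c, hc, hm, hl⟩ := h
  refine ⟨_, hc.map [i], fun v hv => ?_, by simpa using hl⟩
  obtain ⟨w, hw, rfl⟩ := List.mem_map.1 hv
  simp [hm w hw]

theorem joined_zero (x y : Carpet) : Joined 0 1 x y :=
  ⟨[[]], Path.single (mem_cell_nil x) (mem_cell_nil y), by simp, by simp⟩

/-- The point `i000…`; these six points are the ends of the three sides of the carpet. -/
def endpt (i : Fin 6) : Carpet := Quotient.mk _ (shift i fun _ => 0)

theorem letterMap_endpt_zero (i : Fin 6) : letterMap i (endpt 0) = endpt i := by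
  change Quotient.mk _ (shift i (shift 0 fun _ => 0)) = Quotient.mk _ (shift i fun _ => 0)
  congr 2
  funext n
  cases n <;> rfl

theorem letterMap_endpt_of_even {i a : Fin 6} (hi : Even i.val) (ha : a = 1 ∨ a = 2) :
    letterMap i (endpt a) = letterMap (i + 1) (endpt a) :=
  Quotient.sound (.rel _ _ (Glue.even [] i a _ hi ha fun _ => .inl rfl))

theorem letterMap_endpt_of_odd {i a : Fin 6} (hi : Odd i.val) (ha : a = 3 ∨ a = 4) :
    letterMap i (endpt a) = letterMap (i + 1) (endpt a) :=
  Quotient.sound (.rel _ _ (Glue.odd [] i a _ hi ha fun _ => .inl rfl))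

/-- The two points are ends of two sides at a common corner. Cells i and i + 1 share a side issuing
from that corner, and each contains a copy of the same problem, so the count doubles. -/
theorem joined_endpt_of_even (m : ℕ) {i : Fin 6} (hi : Even i.val) :
    Joined m (2 ^ m) (endpt i) (endpt (i + 1)) := by
  induction m generalizing i with
  | zero => exact joined_zero _ _
  | succ m ih =>
    have h := ih (i := 0) (by decide)
    have h₁ := h.letterMap i
    have h₂ := (h.letterMap (i + 1)).symm
    rw [zero_add, letterMap_endpt_zero] at h₁ h₂
    rw [letterMap_endpt_of_even hi (.inl rfl)] at h₁
    exact (h₁.trans h₂).mono (by rw [pow_succ]; omega)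

/-- The two points are the ends of one side. The cells i and i + 1 meet at i4000…; inside each, the
route from 0 to 4 follows a side to 5 and then turns a corner. -/
theorem joined_endpt_of_odd (m : ℕ) {i : Fin 6} (hi : Odd i.val) :
    Joined m ((m + 1) * 2 ^ m) (endpt i) (endpt (i + 1)) := by
  induction m generalizing i with
  | zero => exact joined_zero _ _
  | succ m ih =>
    have h : Joined m ((m + 1) * 2 ^ m + 2 ^ m) (endpt 0) (endpt 4) :=
      (ih (i := 5) (by decide)).symm.trans (joined_endpt_of_even m (i := 4) (by decide)).symm
    have h₁ := h.letterMap i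
    have h₂ := (h.letterMap (i + 1)).symm
    rw [letterMap_endpt_zero] at h₁ h₂
    rw [letterMap_endpt_of_odd hi (.inr rfl)] at h₁
    exact (h₁.trans h₂).mono (le_of_eq (by ring))

theorem joined_endpt_succ (m : ℕ) (i : Fin 6) :
    Joined m ((m + 1) * 2 ^ m) (endpt i) (endpt (i + 1)) := by
  rcases Nat.even_or_odd i.val with hi | hi
  · exact (joined_endpt_of_even m hi).mono (Nat.le_mul_of_pos_left _ (by omega))
  · exact joined_endpt_of_odd m hi

theorem joined_endpt_zero (m : ℕ) (i : Fin 6) :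
    Joined m (5 * ((m + 1) * 2 ^ m)) (endpt i) (endpt 0) := by
  have h : ∀ k : ℕ, Joined m (k * ((m + 1) * 2 ^ m)) (endpt (Fin.ofNat 6 k)) (endpt 0) := by
    intro k
    induction k with
    | zero => exact (Joined.refl m _).mono (Nat.zero_le _)
    | succ k ih =>
      have h₁ : Fin.ofNat 6 (k + 1) = Fin.ofNat 6 k + 1 := by
        ext; simp [Fin.val_add]
      rw [h₁]
      exact ((joined_endpt_succ m _).symm.trans ih).mono (le_of_eq (by ring))
  have := h i.val
  rw [Fin.ofNat_val_eq_self] at this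
  exact this.mono (Nat.mul_le_mul_right _ (by omega))

theorem joined_endpt (m : ℕ) (x : Carpet) : Joined m (10 * ((m + 1) * 2 ^ m)) x (endpt 0) := by
  induction m generalizing x with
  | zero => exact (joined_zero _ _).mono (by norm_num)
  | succ m ih =>
    obtain ⟨i, y, rfl⟩ := exists_letterMap_eq x
    have h := (ih y).letterMap i
    rw [letterMap_endpt_zero] at h
    refine (h.trans (joined_endpt_zero (m + 1) i)).mono ?_
    rw [pow_succ]
    nlinarith [Nat.zero_le (2 ^ m)]

theorem joined (m : ℕ) (x y : Carpet) : Joined m (20 * ((m + 1) * 2 ^ m)) x y :=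
  ((joined_endpt m x).trans (joined_endpt m y).symm).mono (le_of_eq (by ring))

/-! ### Refining paths and the θ-chain condition -/

theorem exists_bound_mul_pow {l : ℝ} (hl : 2 < l) :
    ∃ C : ℝ, 0 < C ∧ ∀ m : ℕ, ((20 * ((m + 1) * 2 ^ m) : ℕ) : ℝ) ≤ C * l ^ m := by
  have h₁ := tendsto_pow_const_mul_const_pow_of_abs_lt_one 1 (r := 2 / l)
    (by rw [abs_of_pos (by positivity)]; rw [div_lt_one (by linarith)]; exact hl)
  obtain ⟨B, hB⟩ := h₁.bddAbove_range
  have hB₀ : 0 ≤ B := by simpa using hB ⟨0, rfl⟩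
  refine ⟨20 * (B + 1), by positivity, fun m => ?_⟩
  have h₂ : (m : ℝ) ^ 1 * (2 / l) ^ m ≤ B := hB ⟨m, rfl⟩
  have hlm : 0 < l ^ m := pow_pos (by linarith) m
  have h₃ : (2 : ℝ) ^ m ≤ l ^ m := pow_le_pow_left₀ (by norm_num) hl.le m
  rw [pow_one, div_pow, ← mul_div_assoc, div_le_iff₀ hlm] at h₂
  push_cast
  linarith

/-- A path of weight at most `s` can be refined into one whose cells have weight at most
`s / n ^ θ`, with total weight at most a constant times `n * (s / n ^ θ)`. -/
theorem exists_refinement {μ θ : ℝ} (hμ : 1 / 2 ≤ μ) (hμ' : μ < 1) (hθ : 0 < θ)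
    (hθ' : θ < -Real.log μ / Real.log 2) :
    ∃ C : ℝ, 0 < C ∧ ∀ (n : ℕ), 1 ≤ n → ∀ s : ℝ, 0 < s → ∀ (x y : Carpet) (c : List Word),
      Path x c y → chainWeight μ c ≤ s → ∃ c', Path x c' y ∧
        (∀ w ∈ c', μ ^ w.length ≤ s / (n : ℝ) ^ θ) ∧
        chainWeight μ c' ≤ C * (n * (s / (n : ℝ) ^ θ)) := by
  have hμ₀ : 0 < μ := by linarith
  have hlog2 : 0 < Real.log 2 := Real.log_pos (by norm_num)
  have hθ₁ : θ ≤ 1 := by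
    refine hθ'.le.trans ?_
    rw [div_le_one hlog2]
    have := Real.log_le_log (by norm_num) hμ
    rw [one_div, Real.log_inv] at this
    linarith
  have hl : 2 < μ ^ (-θ⁻¹) := by
    rw [← Real.log_lt_log_iff (by norm_num) (by positivity), Real.log_rpow hμ₀]
    rw [lt_div_iff₀ hlog2] at hθ'
    rw [neg_mul, ← mul_neg, inv_mul_eq_div, lt_div_iff₀ hθ]
    linarith
  obtain ⟨D, hD₀, hD⟩ := exists_bound_mul_pow hl
  -- The summand 1 serves cells that are already light enough, the other one those that get refined.
  set C : ℝ := 1 + D * μ ^ (-θ⁻¹) with hC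
  have hC₀ : 0 < D * μ ^ (-θ⁻¹) := by positivity
  refine ⟨C, by positivity, fun n hn s hs x y c hp hc => ?_⟩
  have hn' : (1 : ℝ) ≤ n := by exact_mod_cast hn
  set δ : ℝ := s / (n : ℝ) ^ θ with hδ
  have hδ₀ : 0 < δ := by positivity
  have hsδ : s ≤ n * δ := by
    have : (n : ℝ) ^ θ ≤ n := by
      simpa using Real.rpow_le_rpow_of_exponent_le hn' hθ₁
    have h₂ : s = (n : ℝ) ^ θ * δ := by rw [hδ]; field_simp
    rw [h₂]
    gcongr
  have key : ∀ w : Word, μ ^ w.length ≤ s → ∀ x ∈ cell w, ∀ y ∈ cell w, ∃ c', Path x c' y ∧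
      (∀ w ∈ c', μ ^ w.length ≤ δ) ∧
      chainWeight μ c' ≤ C * (n * δ / s) * μ ^ w.length := by
    intro w hw x hx y hy
    have hns : 1 ≤ n * δ / s := by rwa [one_le_div hs]
    by_cases hwδ : μ ^ w.length ≤ δ
    · refine ⟨[w], Path.single hx hy, by simpa using hwδ, ?_⟩
      rw [chainWeight_cons]
      simp only [chainWeight, List.map_nil, List.sum_nil, add_zero]
      refine le_mul_of_one_le_left (by positivity) ?_
      nlinarith
    · have hex : ∃ m : ℕ, μ ^ (w.length + m) ≤ δ := by
        obtain ⟨m, hm⟩ := exists_pow_lt_of_lt_one hδ₀ hμ'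
        exact ⟨m, (pow_le_pow_of_le_one hμ₀.le hμ'.le (by omega)).trans hm.le⟩
      classical
      -- The least admissible m; minimality gives the lower bound, losing one factor μ.
      obtain ⟨m, hm, hmin⟩ : ∃ m : ℕ, μ ^ (w.length + m) ≤ δ ∧ δ * μ ≤ μ ^ (w.length + m) := by
        refine ⟨Nat.find hex, Nat.find_spec hex, ?_⟩
        have hpos : 0 < Nat.find hex := by
          rw [Nat.find_pos]
          simpa using hwδ
        obtain ⟨k, hk⟩ := Nat.exists_eq_succ_of_ne_zero hpos.ne'
        have := Nat.find_min hex (m := k) (by omega)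
        rw [hk, Nat.succ_eq_add_one, ← add_assoc, pow_succ]
        push Not at this
        gcongr
      obtain ⟨x', -, rfl⟩ := hx
      obtain ⟨y', -, rfl⟩ := hy
      obtain ⟨c', hp', hm', hl'⟩ := joined m x' y'
      have hlen : ∀ v ∈ c'.map (w ++ ·), v.length = w.length + m := by
        intro v hv
        obtain ⟨u, hu, rfl⟩ := List.mem_map.1 hv
        simp [hm' u hu]
      refine ⟨_, hp'.map w, fun v hv => by rwa [hlen v hv], ?_⟩
      rw [chainWeight_eq_of_length hlen, List.length_map]
      have h₁ : (c'.length : ℝ) ≤ D * (μ ^ (-θ⁻¹)) ^ m := le_trans (by exact_mod_cast hl') (hD m)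
      -- Minimality of m bounds μ^(-m), whose power 1/θ is the left side. As 1/θ ≥ 1 and μ^|w|/s ≤
      -- 1, the power of this ratio is at most the ratio itself, so the bound is linear in the
      -- weight of the cell and can be summed along the path.
      have h₂ : (μ ^ (-θ⁻¹)) ^ m ≤ μ ^ (-θ⁻¹) * (n * (μ ^ w.length / s)) := by
        have e₁ : (μ ^ (-θ⁻¹)) ^ m = ((μ ^ m)⁻¹) ^ θ⁻¹ := by
          rw [Real.rpow_neg hμ₀.le, inv_pow, Real.inv_rpow (by positivity), ← Real.rpow_natCast,
            ← Real.rpow_natCast, ← Real.rpow_mul hμ₀.le, ← Real.rpow_mul hμ₀.le, mul_comm]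
        have e₂ : (μ ^ m)⁻¹ ≤ μ⁻¹ * ((n : ℝ) ^ θ * (μ ^ w.length / s)) := by
          rw [inv_le_iff_one_le_mul₀ (by positivity)]
          have : δ * μ ≤ μ ^ w.length * μ ^ m := by rwa [← pow_add]
          calc (1 : ℝ) = (δ * μ) * (μ⁻¹ * ((n : ℝ) ^ θ * s⁻¹)) := by rw [hδ]; field_simp
            _ ≤ (μ ^ w.length * μ ^ m) * (μ⁻¹ * ((n : ℝ) ^ θ * s⁻¹)) := by gcongr
            _ = _ := by ring
        have hr : μ ^ w.length / s ≤ 1 := by rwa [div_le_one hs]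
        have hr₀ : 0 < μ ^ w.length / s := by positivity
        calc (μ ^ (-θ⁻¹)) ^ m = ((μ ^ m)⁻¹) ^ θ⁻¹ := e₁
          _ ≤ (μ⁻¹ * ((n : ℝ) ^ θ * (μ ^ w.length / s))) ^ θ⁻¹ := by gcongr
          _ = μ ^ (-θ⁻¹) * (n * (μ ^ w.length / s) ^ θ⁻¹) := by
            rw [Real.mul_rpow (by positivity) (by positivity),
              Real.mul_rpow (by positivity) (by positivity), Real.rpow_rpow_inv (by positivity)
              hθ.ne', Real.inv_rpow hμ₀.le, Real.rpow_neg hμ₀.le]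
          _ ≤ μ ^ (-θ⁻¹) * (n * (μ ^ w.length / s)) := by
            gcongr
            simpa using Real.rpow_le_rpow_of_exponent_ge hr₀ hr
              ((one_le_inv₀ hθ).2 hθ₁)
      calc (c'.length : ℝ) * μ ^ (w.length + m)
          ≤ (D * (μ ^ (-θ⁻¹) * (n * (μ ^ w.length / s)))) * δ := by
            gcongr
            exact h₁.trans (by gcongr)
        _ = (D * μ ^ (-θ⁻¹)) * (n * δ / s) * μ ^ w.length := by ring
        _ ≤ C * (n * δ / s) * μ ^ w.length := by
            gcongr
            linarith
  suffices ∃ c', Path x c' y ∧ (∀ w ∈ c', μ ^ w.length ≤ δ) ∧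
      chainWeight μ c' ≤ C * (n * δ / s) * chainWeight μ c by
    obtain ⟨c', hp', h₁, h₂⟩ := this
    refine ⟨c', hp', h₁, h₂.trans ?_⟩
    calc C * (n * δ / s) * chainWeight μ c ≤ C * (n * δ / s) * s := by gcongr
      _ = C * (n * δ) := by field_simp
  have hcs : ∀ w ∈ c, μ ^ w.length ≤ s := fun w hw =>
    (pow_length_le_chainWeight hμ₀.le hw).trans hc
  clear hc
  induction c generalizing x with
  | nil => exact ⟨[], hp, by simp, by simp [chainWeight]⟩
  | cons w c ih =>
    obtain ⟨p, hx, hp, h⟩ := hp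
    obtain ⟨c₁, hp₁, h₁, k₁⟩ := key w (hcs w List.mem_cons_self) x hx p hp
    obtain ⟨c₂, hp₂, h₂, k₂⟩ := ih p h fun w hw => hcs w (List.mem_cons_of_mem _ hw)
    refine ⟨c₁ ++ c₂, hp₁.append hp₂, fun v hv => (List.mem_append.1 hv).elim (h₁ v) (h₂ v), ?_⟩
    rw [chainWeight_append, chainWeight_cons, mul_add]
    linarith

theorem thetaChainCondition_intrinsicDist {μ θ : ℝ} (hμ : 1 / 2 ≤ μ) (hμ' : μ < 1) (hθ : 0 < θ)
    (hθ' : θ < -Real.log μ / Real.log 2) : ThetaChainCondition θ (intrinsicDist μ) := by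
  have hμ₀ : 0 ≤ μ := by linarith
  obtain ⟨C, hC, key⟩ := exists_refinement hμ hμ' hθ hθ'
  refine ⟨2 * (C + 1), by positivity, fun x y n hn => ?_⟩
  obtain ⟨n, rfl⟩ : ∃ k, n = k + 1 := ⟨n - 1, by omega⟩
  rcases (intrinsicDist_nonneg hμ₀ x y).eq_or_lt with h₀ | h₀
  · refine ⟨fun i => if i = 0 then x else y, by simp, by simp [Fin.ext_iff], fun i => ?_⟩
    rw [← h₀, zero_div, mul_zero]
    dsimp only
    split_ifs with h₁ h₂ h₂
    · exact (intrinsicDist_self hμ₀ hμ' x).le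
    · exact h₀.ge
    · exact absurd h₂ (Fin.succ_ne_zero i)
    · exact (intrinsicDist_self hμ₀ hμ' y).le
  -- The infimum need not be attained, hence the factor 2.
  · obtain ⟨c, hc, hs⟩ := exists_path_of_intrinsicDist_lt
      (show intrinsicDist μ x y < 2 * intrinsicDist μ x y by linarith)
    obtain ⟨c', hc', hδ, hw⟩ := key (n + 1) hn _ (by linarith) x y c hc hs.le
    obtain ⟨z, hz₀, hz₁, hz⟩ := hc'.exists_subdivision hμ₀ hμ'
      (t := C * (2 * intrinsicDist μ x y / ((n + 1 : ℕ) : ℝ) ^ θ)) (by positivity) (by positivity)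
      n hδ (hw.trans_eq (by ring))
    refine ⟨fun i => z i, hz₀, hz₁, fun i => ?_⟩
    refine (hz i i.isLt).trans_eq ?_
    ring


/-! ### Labels on the triangles of the barycentric subdivision -/

/-- Values attached to a triangle with sides `A`, `B`, `C`: one for each side and one for each
corner. -/
structure Labels where
  a : ℝ
  b : ℝ
  c : ℝ
  ab : ℝ
  bc : ℝ
  ca : ℝ

/-- All side values, and all corner values, are within `r` of each other. -/
structure Labels.Close (s : Labels) (r : ℝ) : Prop where
  hab : |s.a - s.b| ≤ r
  hbc : |s.b - s.c| ≤ r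
  hca : |s.c - s.a| ≤ r
  hab_bc : |s.ab - s.bc| ≤ r
  hbc_ca : |s.bc - s.ca| ≤ r
  hca_ab : |s.ca - s.ab| ≤ r

/-- The labels of the triangle of the barycentric subdivision which has its side `C` on a side with
value `o`, next to the corner with value `p`. The side with value `o` meets the sides with values
`s` and `s'` in the corners with values `p` and `p'`, respectively; the barycenter has value `g`. -/
noncomputable def Labels.sub (δ κ g o s s' p p' : ℝ) : Labels where
  a := (o + s) / 2 + κ * p
  b := max (max (o + κ * p) (o + κ * p')) (max ((o + s) / 2 + κ * p) ((o + s') / 2 + κ * p')) - δ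
  c := o + κ * p
  ab := g
  bc := (p + p') / 2
  ca := p

/-- The value at the barycenter. -/
noncomputable def Labels.center (δ : ℝ) (l : Labels) : ℝ := max l.ab (max l.bc l.ca) - δ

/-- The labels of the triangle with letter `i` of the barycentric subdivision. -/
noncomputable def Labels.child (δ κ : ℝ) (l : Labels) (i : Fin 6) : Labels :=
  match i with
  | 0 => .sub δ κ (l.center δ) l.c l.a l.b l.ca l.bc
  | 1 => .sub δ κ (l.center δ) l.a l.c l.b l.ca l.ab
  | 2 => .sub δ κ (l.center δ) l.a l.b l.c l.ab l.ca
  | 3 => .sub δ κ (l.center δ) l.b l.a l.c l.ab l.bc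
  | 4 => .sub δ κ (l.center δ) l.b l.c l.a l.bc l.ab
  | 5 => .sub δ κ (l.center δ) l.c l.b l.a l.bc l.ca

/-- The maximum of numbers within 2δ of each other, minus δ, is within δ of all of them. The four
numbers in `b` are the A and C values of the triangle and of its mirror image across side B, so both
triangles get the same `b`. The bound κ ≤ 1/2 keeps the two corner contributions within δ. -/
theorem Labels.sub_close {δ κ g o s s' p p' : ℝ} (hκ : 0 ≤ κ) (hκ' : κ ≤ 1 / 2)
    (h₁ : |o - s| ≤ 2 * δ) (h₂ : |o - s'| ≤ 2 * δ) (h₃ : |s - s'| ≤ 2 * δ)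
    (hp : |p - p'| ≤ 2 * δ) (hg : |g - p| ≤ δ) (hg' : |g - (p + p') / 2| ≤ δ) :
    (Labels.sub δ κ g o s s' p p').Close δ := by
  have hκp : |κ * p - κ * p'| ≤ δ := by
    rw [← mul_sub, abs_mul, abs_of_nonneg hκ]
    nlinarith [abs_nonneg (p - p')]
  rw [abs_le] at h₁ h₂ h₃ hp hg hg' hκp
  set q := κ * p
  set q' := κ * p'
  have hM₁ : max (max (o + q) (o + q')) (max ((o + s) / 2 + q) ((o + s') / 2 + q')) ≤
      o + q + 2 * δ := by
    refine max_le (max_le ?_ ?_) (max_le ?_ ?_) <;> linarith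
  have hM₂ : max (max (o + q) (o + q')) (max ((o + s) / 2 + q) ((o + s') / 2 + q')) ≤
      (o + s) / 2 + q + 2 * δ := by
    refine max_le (max_le ?_ ?_) (max_le ?_ ?_) <;> linarith
  have hM₃ : o + q ≤ max (max (o + q) (o + q')) (max ((o + s) / 2 + q) ((o + s') / 2 + q')) :=
    le_max_of_le_left (le_max_left _ _)
  have hM₄ : (o + s) / 2 + q ≤
      max (max (o + q) (o + q')) (max ((o + s) / 2 + q) ((o + s') / 2 + q')) :=
    le_max_of_le_right (le_max_left _ _)
  constructor <;> simp only [Labels.sub] <;> rw [abs_le] <;> constructor <;> linarith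

theorem Labels.Close.child {δ κ : ℝ} (hκ : 0 ≤ κ) (hκ' : κ ≤ 1 / 2) {l : Labels}
    (h : l.Close (2 * δ)) (i : Fin 6) : (l.child δ κ i).Close δ := by
  obtain ⟨h₁, h₂, h₃, h₄, h₅, h₆⟩ := h
  have h₁' := abs_sub_comm l.a l.b ▸ h₁
  have h₂' := abs_sub_comm l.b l.c ▸ h₂
  have h₃' := abs_sub_comm l.c l.a ▸ h₃
  have h₄' := abs_sub_comm l.ab l.bc ▸ h₄
  have h₅' := abs_sub_comm l.bc l.ca ▸ h₅
  have h₆' := abs_sub_comm l.ca l.ab ▸ h₆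
  have e₁ : l.ab ≤ max l.ab (max l.bc l.ca) := le_max_left _ _
  have e₂ : l.bc ≤ max l.ab (max l.bc l.ca) := le_max_of_le_right (le_max_left _ _)
  have e₃ : l.ca ≤ max l.ab (max l.bc l.ca) := le_max_of_le_right (le_max_right _ _)
  have k₄ := abs_le.1 h₄
  have k₅ := abs_le.1 h₅
  have k₆ := abs_le.1 h₆
  have f₁ : max l.ab (max l.bc l.ca) ≤ l.ab + 2 * δ := by
    refine max_le ?_ (max_le ?_ ?_) <;> linarith
  have f₂ : max l.ab (max l.bc l.ca) ≤ l.bc + 2 * δ := by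
    refine max_le ?_ (max_le ?_ ?_) <;> linarith
  have f₃ : max l.ab (max l.bc l.ca) ≤ l.ca + 2 * δ := by
    refine max_le ?_ (max_le ?_ ?_) <;> linarith
  fin_cases i <;> refine Labels.sub_close hκ hκ' ?_ ?_ ?_ ?_ ?_ ?_ <;>
    first
    | assumption
    | (rw [Labels.center, abs_le]; constructor <;> linarith)

/-- With κ = 0 the new `c` is one of the three old side values; this yields convergence past level
M. -/
theorem Labels.Close.abs_child_c_sub_le {δ r : ℝ} {l : Labels} (h : l.Close r)
    (i : Fin 6) : |(l.child δ 0 i).c - l.c| ≤ r := by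
  obtain ⟨h₁, h₂, h₃, -, -, -⟩ := h
  have h₃' := abs_sub_comm l.c l.a ▸ h₃
  have h₀ : 0 ≤ r := (abs_nonneg _).trans h₁
  fin_cases i <;> simpa [Labels.child, Labels.sub]

/-- The labels of the cells of level `n` along an infinite word, where corner values contribute to
side values up to level `M` only. -/
noncomputable def labels (M : ℕ) (v : InfWord) : ℕ → Labels
  -- The only nonzero value is at the corner `bc`, the end of side C where the word 5000… sits.
  | 0 => ⟨0, 0, 0, 0, 1, 0⟩
  | n + 1 => (labels M v n).child ((1 / 2) ^ (n + 1)) (if n < M then 1 / 2 else 0) (v n)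

theorem labels_close (M : ℕ) (v : InfWord) (n : ℕ) : (labels M v n).Close ((1 / 2) ^ n) := by
  induction n with
  | zero => constructor <;> norm_num [labels]
  | succ n ih =>
    refine Labels.Close.child ?_ ?_ ?_ _
    · split_ifs <;> norm_num
    · split_ifs <;> norm_num
    · convert ih using 1
      rw [pow_succ]
      ring

theorem labels_congr (M : ℕ) {v v' : InfWord} {n : ℕ} (h : ∀ k < n, v k = v' k) :
    labels M v n = labels M v' n := by
  induction n with
  | zero => rfl
  | succ n ih =>
    rw [labels, labels, ih fun k hk => h k (by omega), h n (by omega)]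

/-- The value, and the values of the corners, of the side `C`. -/
def Labels.sideC (l : Labels) : ℝ × ℝ × ℝ := (l.c, l.bc, l.ca)

/-- Letters 0 and 5 are the halves of side C, so a tail in {0, 5} sees no other side. -/
theorem Labels.child_sideC_of_sideC_eq {δ κ : ℝ} {l l' : Labels} (h : l.sideC = l'.sideC)
    {i : Fin 6} (hi : i = 0 ∨ i = 5) : (l.child δ κ i).sideC = (l'.child δ κ i).sideC := by
  simp only [Labels.sideC, Prod.mk.injEq] at h ⊢
  obtain ⟨h₁, h₂, h₃⟩ := h
  rcases hi with rfl | rfl <;> simp [Labels.child, Labels.sub, h₁, h₂, h₃]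

/-- The value, and the values of the corners, of the side `A`. -/
def Labels.sideA (l : Labels) : ℝ × ℝ × ℝ := (l.a, l.ab, l.ca)

/-- The value, and the values of the corners, of the side `B`. -/
def Labels.sideB (l : Labels) : ℝ × ℝ × ℝ := (l.b, l.ab, l.bc)

theorem Labels.sub_sideA_swap (δ κ g o s r r' p p' p'' : ℝ) :
    (Labels.sub δ κ g o s r p p').sideA = (Labels.sub δ κ g s o r' p p'').sideA := by
  simp only [Labels.sub, Labels.sideA, add_comm o s]

theorem Labels.sub_sideB_swap (δ κ g o s s' p p' : ℝ) :
    (Labels.sub δ κ g o s s' p p').sideB = (Labels.sub δ κ g o s' s p' p).sideB := by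
  simp only [Labels.sub, Labels.sideB, add_comm p p']
  rw [max_comm (o + κ * p), max_comm ((o + s) / 2 + κ * p)]

/-- The common side joins a corner to the barycenter; exchanging the triangles exchanges `o` and
`s`. -/
theorem Labels.child_sideA_of_even {δ κ : ℝ} (l : Labels) {i : Fin 6} (hi : Even i.val) :
    (l.child δ κ i).sideA = (l.child δ κ (i + 1)).sideA := by
  obtain rfl | rfl | rfl : i = 0 ∨ i = 2 ∨ i = 4 := by revert i; decide
  all_goals exact Labels.sub_sideA_swap ..

/-- The common side joins a midpoint to the barycenter; exchanging the triangles exchanges `s`, `s'`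
and `p`, `p'`. -/
theorem Labels.child_sideB_of_odd {δ κ : ℝ} (l : Labels) {i : Fin 6} (hi : Odd i.val) :
    (l.child δ κ i).sideB = (l.child δ κ (i + 1)).sideB := by
  obtain rfl | rfl | rfl : i = 1 ∨ i = 3 ∨ i = 5 := by revert i; decide
  all_goals exact Labels.sub_sideB_swap ..

theorem Labels.child_sideC_of_sideA_eq {δ κ : ℝ} {l l' : Labels} (h : l.sideA = l'.sideA)
    {i : Fin 6} (hi : i = 1 ∨ i = 2) : (l.child δ κ i).sideC = (l'.child δ κ i).sideC := by
  simp only [Labels.sideA, Prod.mk.injEq] at h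
  obtain ⟨h₁, h₂, h₃⟩ := h
  rcases hi with rfl | rfl <;> simp [Labels.child, Labels.sub, Labels.sideC, h₁, h₂, h₃]

theorem Labels.child_sideC_of_sideB_eq {δ κ : ℝ} {l l' : Labels} (h : l.sideB = l'.sideB)
    {i : Fin 6} (hi : i = 3 ∨ i = 4) : (l.child δ κ i).sideC = (l'.child δ κ i).sideC := by
  simp only [Labels.sideB, Prod.mk.injEq] at h
  obtain ⟨h₁, h₂, h₃⟩ := h
  rcases hi with rfl | rfl <;> simp [Labels.child, Labels.sub, Labels.sideC, h₁, h₂, h₃]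

theorem prepend_apply_of_lt (w : Word) (v v' : InfWord) {k : ℕ} (hk : k < w.length) :
    prepend w v k = prepend w v' k := by
  induction w generalizing k with
  | nil => simp at hk
  | cons i w ih =>
    cases k with
    | zero => rfl
    | succ k => exact ih (by simpa using hk)

theorem prepend_apply_length_add (w : Word) (v : InfWord) (k : ℕ) :
    prepend w v (w.length + k) = v k := by
  induction w with
  | nil => simp [prepend]
  | cons i w ih =>
    rw [List.length_cons, Nat.add_right_comm]
    exact ih

theorem labels_prepend_add_one (M : ℕ) (w : Word) (v : InfWord) (k : ℕ) :
    labels M (prepend w v) (w.length + k + 1) =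
      (labels M (prepend w v) (w.length + k)).child ((1 / 2) ^ (w.length + k + 1))
        (if w.length + k < M then 1 / 2 else 0) (v k) := by
  rw [labels, prepend_apply_length_add]

/-- The labels agree after w. The hypothesis on i, j and a makes side C agree two levels later, and
the letters 0 and 5 preserve this. -/
theorem sideC_prepend_eq (M : ℕ) (w : Word) {i j a : Fin 6} {v : InfWord}
    (hv : ∀ n, v n = 0 ∨ v n = 5)
    (hl : ∀ (l : Labels) (δ κ δ' κ' : ℝ), ((l.child δ κ i).child δ' κ' a).sideC =
      ((l.child δ κ j).child δ' κ' a).sideC) (n : ℕ) :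
    (labels M (prepend w (shift i (shift a v))) (w.length + 2 + n)).sideC =
      (labels M (prepend w (shift j (shift a v))) (w.length + 2 + n)).sideC := by
  induction n with
  | zero =>
    have e := labels_congr M (n := w.length) fun k hk =>
      prepend_apply_of_lt w (shift i (shift a v)) (shift j (shift a v)) hk
    have h₁ := fun v => labels_prepend_add_one M w v 1
    have h₂ := fun v => labels_prepend_add_one M w v 0
    simp only [Nat.add_zero] at h₁ h₂ ⊢
    rw [h₁, h₁, h₂, h₂, e]
    exact hl _ _ _ _ _
  | succ n ih =>
    have h₁ := fun v => labels_prepend_add_one M w v (2 + n)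
    simp only [← Nat.add_assoc] at h₁ ⊢
    rw [h₁, h₁, show shift i (shift a v) (2 + n) = v n by rw [Nat.add_comm]; rfl,
      show shift j (shift a v) (2 + n) = v n by rw [Nat.add_comm]; rfl]
    exact Labels.child_sideC_of_sideC_eq ih (hv n)

theorem Glue.exists_sideC_eq (M : ℕ) {x y : InfWord} (h : Glue x y) :
    ∃ N, ∀ n, (labels M x (N + n)).sideC = (labels M y (N + n)).sideC := by
  cases h with
  | even w i a v hi ha hv =>
    exact ⟨_, sideC_prepend_eq M w hv fun l _ _ _ _ =>
      Labels.child_sideC_of_sideA_eq (l.child_sideA_of_even hi) ha⟩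
  | odd w i a v hi ha hv =>
    exact ⟨_, sideC_prepend_eq M w hv fun l _ _ _ _ =>
      Labels.child_sideC_of_sideB_eq (l.child_sideB_of_odd hi) ha⟩

theorem dist_labels_c_le (M : ℕ) (v : InfWord) (n : ℕ) :
    dist (labels M v (M + n)).c (labels M v (M + (n + 1))).c ≤ (1 / 2) ^ M * (1 / 2) ^ n := by
  rw [dist_comm, Real.dist_eq, ← pow_add, ← Nat.add_assoc, labels, if_neg (by omega)]
  exact (labels_close M v (M + n)).abs_child_c_sub_le _

/-! ### The potential on the carpet -/

/-- The limit of the side values along an infinite word. -/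
noncomputable def potential (M : ℕ) (v : InfWord) : ℝ :=
  Filter.limUnder Filter.atTop fun n => (labels M v (M + n)).c

theorem tendsto_potential (M : ℕ) (v : InfWord) :
    Filter.Tendsto (fun n => (labels M v (M + n)).c) Filter.atTop (nhds (potential M v)) :=
  (cauchySeq_of_le_geometric _ _ (by norm_num) (dist_labels_c_le M v)).tendsto_limUnder

theorem dist_labels_potential_le (M : ℕ) (v : InfWord) {n : ℕ} (hn : M ≤ n) :
    dist (labels M v n).c (potential M v) ≤ 2 * (1 / 2) ^ n := by
  obtain ⟨k, rfl⟩ := Nat.exists_eq_add_of_le hn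
  refine (dist_le_of_le_geometric_of_tendsto _ _ (by norm_num) (dist_labels_c_le M v)
    (tendsto_potential M v) k).trans_eq ?_
  rw [pow_add]
  ring

theorem potential_eq_of_glue (M : ℕ) {x y : InfWord} (h : Glue x y) :
    potential M x = potential M y := by
  obtain ⟨N, hN⟩ := h.exists_sideC_eq M
  refine tendsto_nhds_unique_of_eventuallyEq (tendsto_potential M x) (tendsto_potential M y) ?_
  filter_upwards [Filter.eventually_ge_atTop N] with n hn
  obtain ⟨k, hk⟩ := Nat.exists_eq_add_of_le (show N ≤ M + n by omega)
  rw [hk]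
  exact congrArg Prod.fst (hN k)

/-- The potential as a function on the carpet. -/
noncomputable def carpetPotential (M : ℕ) : Carpet → ℝ :=
  Quotient.lift (potential M) fun x y h => by
    induction h with
    | rel x y h => exact potential_eq_of_glue M h
    | refl x => rfl
    | symm x y _ ih => exact ih.symm
    | trans x y z _ _ ih₁ ih₂ => exact ih₁.trans ih₂

/-- Words starting with w share their labels at level |w|, and past level M each limit stays within
2·2^(-|w|) of the common value. -/
theorem dist_carpetPotential_le (M : ℕ) {w : Word} (hw : M ≤ w.length) {x y : Carpet}
    (hx : x ∈ cell w) (hy : y ∈ cell w) :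
    dist (carpetPotential M x) (carpetPotential M y) ≤ 4 * (1 / 2) ^ w.length := by
  obtain ⟨x, -, rfl⟩ := hx
  obtain ⟨y, -, rfl⟩ := hy
  induction x, y using Quotient.inductionOn₂ with
  | h x y =>
    rw [wordMap_mk, wordMap_mk]
    change dist (potential M (prepend w x)) (potential M (prepend w y)) ≤ _
    have h₁ := dist_labels_potential_le M (prepend w x) hw
    have h₂ := dist_labels_potential_le M (prepend w y) hw
    rw [labels_congr M (v' := prepend w y) fun k hk => prepend_apply_of_lt w x y hk] at h₁
    linarith [dist_triangle_left (potential M (prepend w x)) (potential M (prepend w y))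
      (labels M (prepend w y) w.length).c]

theorem Path.dist_carpetPotential_le {M : ℕ} {c : List Word} {x y : Carpet} (h : Path x c y)
    (hc : ∀ w ∈ c, M ≤ w.length) :
    dist (carpetPotential M x) (carpetPotential M y) ≤ 4 * chainWeight (1 / 2) c := by
  induction c generalizing x with
  | nil =>
    obtain rfl : x = y := h
    simp [chainWeight]
  | cons w c ih =>
    obtain ⟨p, hx, hp, h⟩ := h
    have h₁ := ih h fun w hw => hc w (List.mem_cons_of_mem _ hw)
    have h₂ := Hexacarpet.dist_carpetPotential_le M (hc w List.mem_cons_self) hx hp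
    rw [chainWeight_cons]
    linarith [dist_triangle (carpetPotential M x) (carpetPotential M p) (carpetPotential M y)]

theorem carpetPotential_endpt_zero (M : ℕ) : carpetPotential M (endpt 0) = 0 := by
  have h : ∀ n, (labels M (shift 0 fun _ => 0) n).c = 0 ∧
      (labels M (shift 0 fun _ => 0) n).ca = 0 := by
    intro n
    induction n with
    | zero => exact ⟨rfl, rfl⟩
    | succ n ih =>
      have : shift 0 (fun _ => 0) n = 0 := by cases n <;> rfl
      simp [labels, this, Labels.child, Labels.sub, ih]
  refine tendsto_nhds_unique (tendsto_potential M (shift 0 fun _ => 0)) ?_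
  simp [h]

/-- The word 5000… stays at the corner of value 1, which is `bc` at first and `ca` from level 1 on,
so each of the first M levels adds 1/2. -/
theorem carpetPotential_endpt_five (M : ℕ) : carpetPotential M (endpt 5) = M / 2 := by
  have h : ∀ n, (labels M (shift 5 fun _ => 0) (n + 1)).c = (min M (n + 1) : ℕ) / 2 ∧
      (labels M (shift 5 fun _ => 0) (n + 1)).ca = 1 := by
    intro n
    induction n with
    | zero =>
      rcases Nat.eq_zero_or_pos M with rfl | hM
      · simp [labels, shift, Labels.child, Labels.sub]
      · have : min M 1 = 1 := by omega
        simp [labels, shift, Labels.child, Labels.sub, hM, this]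
    | succ n ih =>
      rw [labels]
      simp only [shift, Labels.child, Labels.sub, ih.1, ih.2, and_true]
      split_ifs with hn
      · rw [min_eq_right (by omega), min_eq_right (by omega)]
        push_cast
        ring
      · rw [min_eq_left (by omega), min_eq_left (by omega)]
        ring
  refine tendsto_nhds_unique (tendsto_potential M (shift 5 fun _ => 0))
    (tendsto_const_nhds.congr' ?_)
  filter_upwards [Filter.eventually_ge_atTop 1] with n hn
  obtain ⟨k, rfl⟩ := Nat.exists_eq_add_of_le' hn
  rw [← Nat.add_assoc, (h _).1, min_eq_left (by omega)]

/-! ### Failure of the chain condition -/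

theorem not_chainCondition_intrinsicDist {μ : ℝ} (hμ : 1 / 2 ≤ μ) (hμ' : μ < 1) :
    ¬ ChainCondition (intrinsicDist μ) := by
  rintro ⟨C, hC, h⟩
  have hμ₀ : 0 < μ := by linarith
  -- Chosen to contradict M/2 ≤ 8C; the choice of n then makes every cell of level at most M heavier
  -- than 2C/n.
  obtain ⟨M, hM⟩ := exists_nat_gt (16 * C)
  obtain ⟨n, hn⟩ := exists_nat_gt (2 * C / μ ^ M)
  have hn₀ : (0 : ℝ) < n := lt_trans (by positivity) hn
  obtain ⟨z, hz₀, hz₁, hz⟩ := h (endpt 0) (endpt 5) n (by exact_mod_cast hn₀)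
  have step : ∀ i : Fin n, dist (carpetPotential M (z i.castSucc)) (carpetPotential M (z i.succ)) ≤
      8 * C / n := by
    intro i
    have hlt : intrinsicDist μ (z i.castSucc) (z i.succ) < 2 * C / n := by
      refine (hz i).trans_lt ?_
      have := intrinsicDist_le_one hμ₀.le (endpt 0) (endpt 5)
      rw [← mul_div_assoc]
      exact div_lt_div_of_pos_right (by nlinarith) hn₀
    obtain ⟨c, hc, hw⟩ := exists_path_of_intrinsicDist_lt hlt
    have hlen : ∀ w ∈ c, M ≤ w.length := by
      intro w hwc
      have h₁ := (pow_length_le_chainWeight hμ₀.le hwc).trans_lt hw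
      have h₂ : 2 * C / n < μ ^ M := by
        rw [div_lt_iff₀ (by positivity)] at hn
        rw [div_lt_iff₀ hn₀]
        linarith
      exact ((pow_lt_pow_iff_right_of_lt_one₀ hμ₀ hμ').1 (h₁.trans h₂)).le
    have h₁ := hc.dist_carpetPotential_le hlen
    -- Here μ ≥ 1/2 turns a bound by the weight for 1/2 into one by the weight for μ.
    have h₂ := chainWeight_mono (by norm_num) hμ c
    have h₃ : 8 * C / n = 4 * (2 * C / n) := by ring
    linarith
  have total : ∀ k (hk : k < n + 1),
      dist (carpetPotential M (z 0)) (carpetPotential M (z ⟨k, hk⟩)) ≤ k * (8 * C / n) := by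
    intro k
    induction k with
    | zero => intro hk; simp
    | succ k ih =>
      intro hk
      have h₁ := ih (by omega)
      have h₂ := step ⟨k, by omega⟩
      refine (dist_triangle _ _ _).trans ((add_le_add h₁ h₂).trans_eq ?_)
      push_cast
      ring
  have h₁ := total n (by omega)
  change dist (carpetPotential M (z 0)) (carpetPotential M (z (Fin.last n))) ≤ _ at h₁
  rw [hz₀, hz₁, carpetPotential_endpt_zero, carpetPotential_endpt_five, dist_comm,
    Real.dist_eq, sub_zero, abs_of_nonneg (by positivity), mul_div_cancel₀ _ hn₀.ne'] at h₁
  linarith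

end Hexacarpet

theorem proposition2p3 (μ : ℝ) (hμ : 1 / 2 ≤ μ) (hμ' : μ < 1) :
    ¬ Hexacarpet.ChainCondition (Hexacarpet.intrinsicDist μ) ∧
      ∀ θ : ℝ, 0 < θ → θ < -Real.log μ / Real.log 2 →
        Hexacarpet.ThetaChainCondition θ (Hexacarpet.intrinsicDist μ) :=
  ⟨Hexacarpet.not_chainCondition_intrinsicDist hμ hμ', fun _ hθ hθ' =>
    Hexacarpet.thetaChainCondition_intrinsicDist hμ hμ' hθ hθ'⟩
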